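/- \emph{Short-range infinite chess} is played on the board $\mathbb Z^2$. A position consists of an arbitrary (finite or infinite) arrangement of white and black kings, queens, rooks, bishops, knights and pawns with exactly one king of each colour, the player to move, and a fifty-move counter. Pieces move, capture, give check and block as in ordinary chess, except that queens, rooks and bishops may move at most seven squares along a direction per turn; White's pawns advance upward and Black's downward, always by a single square; there is no castling, no promotion and hence no en passant. A king may not be captured, and a move may not leave the mover's own king in check. A player who is to move and has no legal move of a piece is checkmated (and loses) if in check; otherwise the game is a draw by stalemate. The game is also drawn when fifty consecutive moves by each side ($100$ half-moves) have been made without a pawn move or a capture and the player to move is not checkmated, and when a position (same arrangement, same player to move) occurs for the third time; infinite play is a draw. In \emph{short-range infinite chess with passing for Black}, Black may in addition pass on his turn instead of moving a piece, unless he is in check. A pass does not reset the fifty-move counter (it counts as a move without a pawn move or a capture), and it does not avert stalemate: if Black is not in check and his only legal option is to pass, the game is a draw. Ordinal game values for White are assigned inductively to finite plays (the current position together with the earlier ones). A play in which Black is to move and is checkmated has value $0$. If the game is not over and White is to move, the play has value $\beta+1$, where $\beta$ is the least value of a play reachable by a legal turn of White, provided that some such play has a value. If the game is not over and Black is to move,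 the play has as its value the supremum of the values of all plays reachable by a legal turn of Black (passes included), provided that all of these have a value. All other plays have no value for White. \textbf{Theorem.} In short-range infinite chess with passing for Black, only finite game values arise for White: for every starting position and every finite play from it, if that play has an ordinal game value $\alpha$ for White, then $\alpha$ is a natural number ($\alpha<\omega$). -/

import Mathlib

namespace ShortRangeChess

inductive Player where
  | white
  | black

def Player.opponent : Player → Player
  | .white => .black
  | .black => .white

/-- The vertical direction in which the pawns of a player advance. -/
def Player.forward : Player → ℤ
  | .white => 1
  | .black => -1

inductive Kind where
  | king
  | queen
  | rook
  | bishop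
  | knight
  | pawn

structure Piece where
  owner : Player
  kind : Kind

/-- Squares are written `(x, y)`: `x` is the file, `y` the rank. -/
abbrev Square := ℤ × ℤ

/-- An arrangement of pieces on the infinite board; any number of pieces is allowed. -/
abbrev Board := Square → Option Piece

/-- The board obtained by moving the piece on `s` to `t`, removing whatever stood on `t`. -/
def Board.afterMove (b : Board) (s t : Square) : Board :=
  Function.update (Function.update b s none) t (b s)

def rookDirections : Set (ℤ × ℤ) := {(1, 0), (-1, 0), (0, 1), (0, -1)}

def bishopDirections : Set (ℤ × ℤ) := {(1, 1), (1, -1), (-1, 1), (-1, -1)}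

/-- `t` is reached from `s` by between one and seven steps along a direction from `D`,
all squares strictly in between being empty. -/
def Slides (b : Board) (D : Set (ℤ × ℤ)) (s t : Square) : Prop :=
  ∃ d ∈ D, ∃ n : ℕ, 1 ≤ n ∧ n ≤ 7 ∧ t = s + n • d ∧
    ∀ m : ℕ, 1 ≤ m → m < n → b (s + m • d) = none

/-- A piece `p` standing on `s` attacks the square `t`. -/
def Attacks (b : Board) (p : Piece) (s t : Square) : Prop :=
  match p.kind with
  | .king => max |t.1 - s.1| |t.2 - s.2| = 1
  | .queen => Slides b (rookDirections ∪ bishopDirections) s t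
  | .rook => Slides b rookDirections s t
  | .bishop => Slides b bishopDirections s t
  | .knight => (|t.1 - s.1| = 1 ∧ |t.2 - s.2| = 2) ∨ (|t.1 - s.1| = 2 ∧ |t.2 - s.2| = 1)
  | .pawn => |t.1 - s.1| = 1 ∧ t.2 = s.2 + p.owner.forward

/-- The king of `c` is attacked by an enemy piece. -/
def InCheck (b : Board) (c : Player) : Prop :=
  ∃ k s p, b k = some ⟨c, .king⟩ ∧ b s = some p ∧ p.owner = c.opponent ∧ Attacks b p s k

/-- The piece `p` on `s` can move to the empty square `t`
(pawns advance by one square, other pieces go to the squares they attack). -/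
def QuietMove (b : Board) (p : Piece) (s t : Square) : Prop :=
  b t = none ∧
    ((p.kind = .pawn ∧ t = (s.1, s.2 + p.owner.forward)) ∨ (p.kind ≠ .pawn ∧ Attacks b p s t))

/-- The piece `p` on `s` can capture an enemy piece on `t`. Kings cannot be captured. -/
def CaptureMove (b : Board) (p : Piece) (s t : Square) : Prop :=
  Attacks b p s t ∧ ∃ q, b t = some q ∧ q.owner = p.owner.opponent ∧ q.kind ≠ .king

/-- Player `c` may legally move a piece from `s` to `t`:
afterwards the king of `c` must not be in check. -/
def LegalMove (b : Board) (c : Player) (s t : Square) : Prop :=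
  (∃ p, b s = some p ∧ p.owner = c ∧ (QuietMove b p s t ∨ CaptureMove b p s t)) ∧
    ¬ InCheck (b.afterMove s t) c

/-- A position: the board, the player to move, and the fifty-move counter, which is the number of
consecutive moves (half-moves, by either player) without a pawn move or a capture. -/
structure Position where
  board : Board
  toMove : Player
  counter : ℕ

/-- Each player has exactly one king. -/
def Position.OneKingEach (p : Position) : Prop :=
  ∀ c : Player, ∃! k : Square, p.board k = some ⟨c, .king⟩

open Classical in
/-- The position after a move from `s` to `t`;
a pawn move or a capture resets the fifty-move counter. -/
noncomputable def Position.afterMove (p : Position) (s t : Square) : Position where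
  board := p.board.afterMove s t
  toMove := p.toMove.opponent
  counter :=
    if (∃ c, p.board s = some ⟨c, .pawn⟩) ∨ p.board t ≠ none then 0 else p.counter + 1

/-- The position after a pass, which does not reset the fifty-move counter. -/
def Position.afterPass (p : Position) : Position where
  board := p.board
  toMove := p.toMove.opponent
  counter := p.counter + 1

/-- The player to move can legally move some piece (passing is not moving a piece). -/
def Position.CanMovePiece (p : Position) : Prop :=
  ∃ s t, LegalMove p.board p.toMove s t

/-- One turn: a legal move of a piece, or, for Black only, a pass.
As always, a player whose king is in check may not leave it there, so Black cannot pass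
when in check. -/
inductive Turn (p : Position) : Position → Prop
  | move (s t : Square) (h : LegalMove p.board p.toMove s t) : Turn p (p.afterMove s t)
  | pass (hb : p.toMove = .black) (hc : ¬ InCheck p.board .black) : Turn p p.afterPass

/-- A finite play: the current position together with all earlier ones, latest first. -/
structure Play where
  current : Position
  past : List Position

/-- The play consisting only of its starting position. -/
def Play.start (p : Position) : Play := ⟨p, []⟩

open Classical in
/-- The current position (same board, same player to move) occurs for at least the third time. -/
def Play.ThreefoldRepetition (g : Play) : Prop :=
  2 ≤ g.past.countP
    (fun q => decide (q.board = g.current.board ∧ q.toMove = g.current.toMove))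

/-- Black is to move and checkmated. -/
def Play.BlackMated (g : Play) : Prop :=
  g.current.toMove = .black ∧ InCheck g.current.board .black ∧ ¬ g.current.CanMovePiece

/-- The game is not over. It is over when the player to move cannot move a piece
(checkmate when in check, otherwise a draw by stalemate, even if Black could still pass), and it
is drawn after fifty moves of each player without a pawn move or a capture, and by threefold
repetition. -/
def Play.Ongoing (g : Play) : Prop :=
  g.current.CanMovePiece ∧ g.current.counter < 100 ∧ ¬ g.ThreefoldRepetition

/-- The play `g'` prolongs `g` by one turn. -/
def Play.Next (g g' : Play) : Prop :=
  g.Ongoing ∧ Turn g.current g'.current ∧ g'.past = g.current :: g.past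

theorem Play.Next.toMove {g g' : Play} (h : g.Next g') :
    g'.current.toMove = g.current.toMove.opponent := by
  obtain ⟨_, h, _⟩ := h
  generalize g'.current = q at h
  cases h <;> rfl

/-- The play `g` has ordinal game value `α` for White:
* it has value `0` if Black is checkmated;
* if the game goes on with White to move, it has value `β + 1`, where `β` is the least value of
  a play that White can reach by a turn, provided that some such play has a value;
* if the game goes on with Black to move, it has as value the supremum of the values of the
  plays that Black can reach by a turn, provided that all of these have a value.

The conditions `β < α`, `γ < β` and `f g' ≤ α` make this a recursion on `α`. -/
def HasGameValue (α : Ordinal.{0}) (g : Play) : Prop :=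
  (g.BlackMated ∧ α = 0) ∨
  (g.Ongoing ∧ g.current.toMove = .white ∧
    ∃ β, ∃ _ : β < α, α = β + 1 ∧
      (∃ g', g.Next g' ∧ HasGameValue β g') ∧
      (∀ γ, ∀ _ : γ < β, ∀ g', g.Next g' → ¬ HasGameValue γ g')) ∨
  (g.Ongoing ∧ ∃ _ : g.current.toMove = .black,
    ∃ f : Play → Ordinal.{0},
      (∀ g', ∀ _ : g.Next g', ∃ _ : f g' ≤ α, HasGameValue (f g') g') ∧
      IsLUB {β | ∃ g', g.Next g' ∧ f g' = β} α)
termination_by (α, (match g.current.toMove with | .white => 0 | .black => 1 : ℕ))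
decreasing_by
  · exact Prod.Lex.left _ _ (by assumption)
  · rename_i hβ hγ _hn
    exact Prod.Lex.left _ _ (lt_trans hγ hβ)
  · rename_i hb hn hle
    rcases lt_or_eq_of_le hle with h | h
    · exact Prod.Lex.left _ _ h
    · have h1 := hn.toMove
      rw [hb] at h1
      rw [h, h1, hb]
      exact Prod.Lex.right _ (by simp [Player.opponent])

end ShortRangeChess

namespace ShortRangeChess

/-! A forced win in `n` moves looks at only finitely many squares, in the current position and the
past ones (`WinsWithin.holdsNear`). This makes the supremum at Black's turns finite
(`exists_uniform_winsWithin`).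

If Black is in check, every legal move starts near his king, since all ranges are bounded, so he has
finitely many moves. If he is not in check, he may pass, and White then wins within some `N` moves
by looking at a finite set `S`. A move that touches no square of `S` leaves the same picture on `S`
as the pass, so White again wins within `N`. Only the finitely many moves touching `S` or starting
or ending near the king remain, and the maximum of finitely many bounds is finite. This is
`exists_finset_of_pass`; it serves both to prove locality and to obtain the uniform bound.

The draw rules respect locality in one direction: a smaller counter and fewer repetitions only help
White. Hence `Play.Similar` asks for an inequality of counters, and a move can replace a pass even
if it resets the counter. -/

/-! ### Bounded reach of the pieces. -/

/-- The squares at king distance at most `r` from `s`. -/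
@[irreducible] noncomputable def ball (r : ℕ) (s : Square) : Finset Square :=
  Finset.Icc (s.1 - r) (s.1 + r) ×ˢ Finset.Icc (s.2 - r) (s.2 + r)

theorem mem_ball {r : ℕ} {s u : Square} :
    u ∈ ball r s ↔ (s.1 - r ≤ u.1 ∧ u.1 ≤ s.1 + r) ∧ (s.2 - r ≤ u.2 ∧ u.2 ≤ s.2 + r) := by
  simp [ball]

theorem mem_ball_comm {r : ℕ} {s u : Square} : u ∈ ball r s ↔ s ∈ ball r u := by
  simp only [mem_ball]; omega

theorem self_mem_ball (r : ℕ) (s : Square) : s ∈ ball r s := by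
  simp only [mem_ball]; omega

theorem mem_ball_trans {q r : ℕ} {s t u : Square} (ht : t ∈ ball q s) (hu : u ∈ ball r t) :
    u ∈ ball (q + r) s := by
  simp only [mem_ball] at *; omega

theorem ball_subset {q r : ℕ} (h : q ≤ r) (s : Square) : ball q s ⊆ ball r s := by
  intro u; simp only [mem_ball]; omega

theorem add_nsmul_mem_ball {d : ℤ × ℤ} (hd : d ∈ rookDirections ∪ bishopDirections) {n : ℕ}
    (hn : n ≤ 7) (s : Square) : s + n • d ∈ ball 7 s := by
  simp only [rookDirections, bishopDirections, Set.mem_union, Set.mem_insert_iff,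
    Set.mem_singleton_iff] at hd
  rw [mem_ball]
  rcases hd with (h | h | h | h) | (h | h | h | h) <;> subst h <;> simp <;> omega

theorem Slides.mem_ball {b : Board} {D : Set (ℤ × ℤ)} {s t : Square}
    (hD : D ⊆ rookDirections ∪ bishopDirections) (h : Slides b D s t) : t ∈ ball 7 s := by
  obtain ⟨d, hd, n, -, hn, rfl, -⟩ := h
  exact add_nsmul_mem_ball (hD hd) hn s

theorem Slides.mono {b b' : Board} {D : Set (ℤ × ℤ)} {s t : Square}
    (hD : D ⊆ rookDirections ∪ bishopDirections)
    (hb : ∀ u ∈ ball 7 s, b u = none → b' u = none) (h : Slides b D s t) : Slides b' D s t := by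
  obtain ⟨d, hd, n, h1, hn, rfl, hm⟩ := h
  exact ⟨d, hd, n, h1, hn, rfl, fun m h1 h2 =>
    hb _ (add_nsmul_mem_ball (hD hd) (h2.le.trans hn) s) (hm m h1 h2)⟩

theorem Attacks.mem_ball {b : Board} {p : Piece} {s t : Square} (h : Attacks b p s t) :
    t ∈ ball 7 s := by
  obtain ⟨o, k⟩ := p
  cases k <;> simp only [Attacks] at h
  · rw [ShortRangeChess.mem_ball]
    have h1 := (le_max_left _ _).trans h.le
    have h2 := (le_max_right _ _).trans h.le
    rw [abs_le] at h1 h2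
    omega
  · exact h.mem_ball subset_rfl
  · exact h.mem_ball Set.subset_union_left
  · exact h.mem_ball Set.subset_union_right
  · rw [ShortRangeChess.mem_ball]
    rcases h with ⟨h1, h2⟩ | ⟨h1, h2⟩ <;>
    · have h1 := abs_le.1 h1.le
      have h2 := abs_le.1 h2.le
      omega
  · rw [ShortRangeChess.mem_ball]
    have h1 := abs_le.1 h.1.le
    have h2 := h.2
    cases o <;> simp only [Player.forward] at h2 <;> omega

/-- The board enters an attack only through empty squares on a line, so emptying further squares
cannot destroy it. -/
theorem Attacks.mono {b b' : Board} {p : Piece} {s t : Square}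
    (hb : ∀ u ∈ ball 7 s, b u = none → b' u = none) (h : Attacks b p s t) : Attacks b' p s t := by
  obtain ⟨o, k⟩ := p
  cases k <;> simp only [Attacks] at h ⊢
  · exact h
  · exact h.mono subset_rfl hb
  · exact h.mono Set.subset_union_left hb
  · exact h.mono Set.subset_union_right hb
  · exact h
  · exact h

/-! ### Locality of check and of legal moves. -/

/-- There is exactly one king of each colour on the board. -/
def Board.OneKingEach (b : Board) : Prop :=
  ∀ c : Player, ∃! k : Square, b k = some ⟨c, .king⟩

theorem Board.OneKingEach.eq {b : Board} (hb : b.OneKingEach) {c : Player} {k l : Square}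
    (hk : b k = some ⟨c, .king⟩) (hl : b l = some ⟨c, .king⟩) : k = l :=
  (hb c).unique hk hl

theorem Board.afterMove_apply (b : Board) (s t u : Square) :
    b.afterMove s t u = if u = t then b s else if u = s then none else b u := by
  simp [Board.afterMove, Function.update_apply]

theorem LegalMove.mem_ball {b : Board} {c : Player} {s t : Square} (h : LegalMove b c s t) :
    t ∈ ball 7 s := by
  obtain ⟨⟨p, -, -, h | h⟩, -⟩ := h
  · obtain ⟨-, ⟨-, rfl⟩ | ⟨-, h⟩⟩ := h
    · rw [ShortRangeChess.mem_ball]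
      obtain ⟨o, k⟩ := p
      cases o <;> simp only [Player.forward] <;> omega
    · exact h.mem_ball
  · exact h.1.mem_ball

theorem LegalMove.target {b : Board} {c : Player} {s t : Square} (h : LegalMove b c s t) :
    b t = none ∨ ∃ q, b t = some q ∧ q.owner = c.opponent ∧ q.kind ≠ .king := by
  obtain ⟨⟨p, -, rfl, h | h⟩, -⟩ := h
  · exact .inl h.1
  · exact .inr h.2

theorem LegalMove.target_ne_king {b : Board} {c d : Player} {s t k : Square}
    (h : LegalMove b c s t) (hk : b k = some ⟨d, .king⟩) : k ≠ t := by
  rintro rfl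
  rcases h.target with h3 | ⟨q, h3, -, h4⟩
  · simp [hk] at h3
  · rw [hk, Option.some.injEq] at h3
    subst h3
    exact h4 rfl

theorem LegalMove.oneKingEach {b : Board} {c : Player} {s t : Square} (h : LegalMove b c s t)
    (hb : b.OneKingEach) : (b.afterMove s t).OneKingEach := by
  intro d
  obtain ⟨k, hk, hu⟩ := hb d
  have hkt := h.target_ne_king hk
  by_cases hks : k = s
  · subst hks
    refine ⟨t, by simp [Board.afterMove_apply, hk], fun l hl => ?_⟩
    simp only [Board.afterMove_apply] at hl
    by_contra hlt
    rw [if_neg hlt] at hl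
    split_ifs at hl with hls
    exact hls (hu l hl)
  · refine ⟨k, by simp [Board.afterMove_apply, hk, hkt, hks], fun l hl => ?_⟩
    simp only [Board.afterMove_apply] at hl
    split_ifs at hl with h1 h2
    · exact (hks (hu s hl).symm).elim
    · exact hu l hl

/-- The radius is 14 = 7 + 7: the attacker is within 7 of the king, and its line within 7 of the
attacker. -/
theorem InCheck.congr {b b' : Board} {c : Player} {k : Square} (hb : b.OneKingEach)
    (hk : b k = some ⟨c, .king⟩) (h : ∀ u ∈ ball 14 k, b' u = b u) (hc : InCheck b c) :
    InCheck b' c := by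
  obtain ⟨l, s, p, hl, hs, hp, ha⟩ := hc
  obtain rfl := hb.eq hk hl
  have hsk : s ∈ ball 7 k := mem_ball_comm.1 ha.mem_ball
  refine ⟨k, s, p, (h k (self_mem_ball _ k)).trans hk,
    (h s (ball_subset (by norm_num) k hsk)).trans hs, hp, ha.mono fun u hu hn => ?_⟩
  exact (h u (mem_ball_trans hsk hu)).trans hn

theorem inCheck_congr {b b' : Board} {c : Player} {k : Square} (hb : b.OneKingEach)
    (hb' : b'.OneKingEach) (hk : b k = some ⟨c, .king⟩) (h : ∀ u ∈ ball 14 k, b' u = b u) :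
    InCheck b' c ↔ InCheck b c :=
  ⟨InCheck.congr hb' ((h k (self_mem_ball _ k)).trans hk) fun u hu => (h u hu).symm,
    InCheck.congr hb hk h⟩

theorem Board.afterMove_congr {b b' : Board} {s t u : Square} (hs : b' s = b s)
    (hu : b' u = b u) : b'.afterMove s t u = b.afterMove s t u := by
  simp [Board.afterMove_apply, hs, hu]

theorem LegalMove.congr {b b' : Board} {c : Player} {k s t : Square} (hb : b.OneKingEach)
    (hb' : b'.OneKingEach) (hk : b k = some ⟨c, .king⟩) (h : ∀ u ∈ ball 14 k, b' u = b u)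
    (hs : ∀ u ∈ ball 21 s, b' u = b u) (hl : LegalMove b c s t) : LegalMove b' c s t := by
  have hts := hl.mem_ball
  have hss : b' s = b s := hs s (self_mem_ball _ s)
  have ht : b' t = b t := hs t (ball_subset (by norm_num) s hts)
  have hone := hl.oneKingEach hb
  have hkt := hl.target_ne_king hk
  obtain ⟨⟨p, h1, h2, h3⟩, h4⟩ := hl
  have hatt : Attacks b p s t → Attacks b' p s t := fun ha =>
    ha.mono fun u hu hn => (hs u (ball_subset (by norm_num) s hu)).trans hn
  refine ⟨⟨p, hss.trans h1, h2, ?_⟩, fun hc => h4 ?_⟩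
  · rcases h3 with ⟨h5, h6⟩ | ⟨h5, h6⟩
    · exact .inl ⟨ht.trans h5, h6.imp_right fun h => ⟨h.1, hatt h.2⟩⟩
    · exact .inr ⟨hatt h5, by rwa [ht]⟩
  · obtain ⟨l, a, q, hl, ha, hq, hat⟩ := hc
    -- The king after the move is either on `t`, within 7 of `s`, or still on `k`; hence the radius
    -- 21 = 7 + 14 around `s`.
    have hlk : ball 14 l ⊆ ball 14 k ∪ ball 21 s := by
      rw [Board.afterMove_apply] at hl
      split_ifs at hl with e1 e2
      · subst e1
        exact fun u hu => Finset.mem_union_right _ (mem_ball_trans hts hu)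
      · have : b' k = some ⟨c, .king⟩ :=
          (h k (self_mem_ball _ k)).trans hk
        obtain rfl := hb'.eq hl this
        exact Finset.subset_union_left
    have hagree : ∀ u ∈ ball 14 l, b'.afterMove s t u = b.afterMove s t u := fun u hu =>
      Board.afterMove_congr hss <| by
        rcases Finset.mem_union.1 (hlk hu) with hu | hu
        · exact h u hu
        · exact hs u hu
    have hal : a ∈ ball 7 l := mem_ball_comm.1 hat.mem_ball
    refine ⟨l, a, q, (hagree l (self_mem_ball _ l)).symm.trans hl,
      (hagree a (ball_subset (by norm_num) l hal)).symm.trans ha, hq, hat.mono fun u hu hn => ?_⟩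
    exact (hagree u (mem_ball_trans hal hu)).symm.trans hn

/-- A legal move out of check starts near the king. -/
theorem LegalMove.source_mem_ball_of_inCheck {b : Board} {c : Player} {k s t : Square}
    (hb : b.OneKingEach) (hk : b k = some ⟨c, .king⟩) (hc : InCheck b c)
    (hl : LegalMove b c s t) : s ∈ ball 21 k := by
  by_contra hsk
  obtain ⟨l, a, q, hlk, ha, hq, hat⟩ := hc
  obtain rfl := hb.eq hk hlk
  have hks : k ≠ s := by
    rintro rfl
    exact hsk (self_mem_ball _ k)
  have htk : t ∉ ball 14 k := fun h =>
    hsk (mem_ball_trans h (mem_ball_comm.1 hl.mem_ball))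
  have hak : a ∈ ball 7 k := mem_ball_comm.1 hat.mem_ball
  have hat' : a ≠ t := by
    rintro rfl
    exact htk (ball_subset (by norm_num) k hak)
  have has : a ≠ s := by
    rintro rfl
    exact hsk (ball_subset (by norm_num) k hak)
  -- Such a move neither captures the checking piece nor blocks its line, and vacating `s` only
  -- opens lines, so the check persists.
  refine hl.2 ⟨k, a, q, ?_, ?_, hq, hat.mono fun u hu hn => ?_⟩
  · simp [Board.afterMove_apply, hks, hl.target_ne_king hk, hk]
  · simp [Board.afterMove_apply, hat', has, ha]
  · have hut : u ≠ t := by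
      rintro rfl
      exact htk (mem_ball_trans hak hu)
    simp [Board.afterMove_apply, hut, hn]

theorem Turn.oneKingEach {p q : Position} (h : Turn p q) (hp : p.board.OneKingEach) :
    q.board.OneKingEach := by
  cases h with
  | move s t h => exact h.oneKingEach hp
  | pass => exact hp

/-! ### Bounded forced wins and similar plays. -/

/-- The play obtained from `g` by reaching the position `q`. -/
def Play.extend (g : Play) (q : Position) : Play := ⟨q, g.current :: g.past⟩

theorem Play.Ongoing.next {g : Play} (hg : g.Ongoing) {q : Position} (h : Turn g.current q) :
    g.Next (g.extend q) := ⟨hg, h, rfl⟩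

theorem Play.Next.eq_extend {g g' : Play} (h : g.Next g') : g' = g.extend g'.current := by
  obtain ⟨c, l⟩ := g'
  obtain ⟨-, -, rfl⟩ := h
  rfl

/-- White can force checkmate from `g` in at most `n` moves. -/
inductive WinsWithin : ℕ → Play → Prop
  | mated {n : ℕ} {g : Play} (h : g.BlackMated) : WinsWithin n g
  | white {n : ℕ} {g g' : Play} (h : g.Ongoing) (hw : g.current.toMove = .white)
      (hn : g.Next g') (hg' : WinsWithin n g') : WinsWithin (n + 1) g
  | black {n : ℕ} {g : Play} (h : g.Ongoing) (hb : g.current.toMove = .black)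
      (hg' : ∀ g', g.Next g' → WinsWithin n g') : WinsWithin n g

theorem WinsWithin.mono {m n : ℕ} {g : Play} (h : WinsWithin m g) (hmn : m ≤ n) :
    WinsWithin n g := by
  induction h generalizing n with
  | mated h => exact .mated h
  | white h hw hn _ ih =>
    obtain ⟨n, rfl⟩ := Nat.exists_eq_add_of_le' (Nat.one_le_of_lt hmn)
    exact .white h hw hn (ih (Nat.le_of_succ_le_succ hmn))
  | black h hb _ ih => exact .black h hb fun g' hg' => ih g' hg' hmn

/-- `g'` looks like `g` on the squares in `S`, in the current and all past positions, and its
fifty-move counter is not larger. -/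
structure Play.Similar (S : Finset Square) (g g' : Play) : Prop where
  board : ∀ u ∈ S, g'.current.board u = g.current.board u
  toMove : g'.current.toMove = g.current.toMove
  counter : g'.current.counter ≤ g.current.counter
  past : List.Forall₂ (fun q q' : Position => q'.toMove = q.toMove ∧
    ∀ u ∈ S, q'.board u = q.board u) g.past g'.past

theorem Play.Similar.mono {S T : Finset Square} {g g' : Play} (h : g.Similar T g') (hST : S ⊆ T) :
    g.Similar S g' :=
  ⟨fun u hu => h.board u (hST hu), h.toMove, h.counter,
    h.past.imp fun _ _ h => ⟨h.1, fun u hu => h.2 u (hST hu)⟩⟩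

theorem Play.Similar.refl (S : Finset Square) (g : Play) : g.Similar S g :=
  ⟨fun _ _ => rfl, rfl, le_rfl, List.forall₂_same.2 fun _ _ => ⟨rfl, fun _ _ => rfl⟩⟩

theorem Play.Similar.extend {S : Finset Square} {g g' : Play} (h : g.Similar S g')
    {q q' : Position} (hb : ∀ u ∈ S, q'.board u = q.board u) (ht : q'.toMove = q.toMove)
    (hc : q'.counter ≤ q.counter) : (g.extend q).Similar S (g'.extend q') :=
  ⟨hb, ht, hc, .cons ⟨h.toMove, h.board⟩ h.past⟩

theorem countP_le_of_forall₂ {α β : Type*} {R : α → β → Prop} {l : List α} {l' : List β}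
    {P : α → Bool} {Q : β → Bool} (h : List.Forall₂ R l l')
    (hPQ : ∀ a ∈ l, ∀ b, R a b → Q b → P a) : l'.countP Q ≤ l.countP P := by
  induction h with
  | nil => simp
  | @cons a b l l' hab _ ih =>
    have ih := ih fun a ha => hPQ a (List.mem_cons_of_mem _ ha)
    have := hPQ a List.mem_cons_self b hab
    simp only [List.countP_cons]
    split_ifs <;> first | omega | simp_all

/-- One square of difference for each unequal board suffices; this makes the absence of threefold
repetition a local condition. -/
theorem exists_separating (b : Board) (l : List Position) :
    ∃ S : Finset Square, ∀ q ∈ l, (∀ u ∈ S, q.board u = b u) → q.board = b := by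
  classical
  induction l with
  | nil => exact ⟨∅, by simp⟩
  | cons a l ih =>
    obtain ⟨S, hS⟩ := ih
    by_cases h : a.board = b
    · exact ⟨S, fun q hq hu => by
        rcases List.mem_cons.1 hq with rfl | hq
        · exact h
        · exact hS q hq hu⟩
    · obtain ⟨v, hv⟩ := Function.ne_iff.1 h
      refine ⟨insert v S, fun q hq hu => ?_⟩
      rcases List.mem_cons.1 hq with rfl | hq
      · exact (hv (hu v (Finset.mem_insert_self _ _))).elim
      · exact hS q hq fun u hu' => hu u (Finset.mem_insert_of_mem hu')

/-! ### Locality of the end of the game. -/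

/-- The game being not over depends on finitely many squares only. -/
theorem Play.Ongoing.exists_finset {g : Play} (h : g.Ongoing) (hg : g.current.board.OneKingEach) :
    ∃ S : Finset Square, ∀ g', g.Similar S g' → g'.current.board.OneKingEach → g'.Ongoing := by
  obtain ⟨⟨s, t, hst⟩, hc, hr⟩ := h
  obtain ⟨k, hk, -⟩ := hg g.current.toMove
  obtain ⟨D, hD⟩ := exists_separating g.current.board g.past
  refine ⟨D ∪ (ball 14 k ∪ ball 21 s), fun g' hs hg' => ⟨⟨s, t, ?_⟩, hs.counter.trans_lt hc, ?_⟩⟩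
  · rw [hs.toMove]
    exact hst.congr hg hg' hk (fun u hu => hs.board u (by simp [hu]))
      (fun u hu => hs.board u (by simp [hu]))
  -- Each repetition in `g'` comes from one in `g`, because agreement on `D` forces equality with
  -- the current board of `g`.
  · refine fun hr' => hr (hr'.trans (countP_le_of_forall₂ hs.past fun q hq q' hqq' h => ?_))
    simp only [decide_eq_true_eq] at h ⊢
    refine ⟨hD q hq fun u hu => ?_, hqq'.1.symm.trans (h.2.trans hs.toMove)⟩
    rw [← hqq'.2 u (by simp [hu]), h.1, hs.board u (by simp [hu])]

/-- Being checkmated depends on finitely many squares only. -/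
theorem Play.BlackMated.exists_finset {g : Play} (h : g.BlackMated)
    (hg : g.current.board.OneKingEach) :
    ∃ S : Finset Square, ∀ g', g.Similar S g' → g'.current.board.OneKingEach →
      g'.BlackMated := by
  obtain ⟨hb, hc, hm⟩ := h
  obtain ⟨k, hk, -⟩ := hg .black
  -- An escape from check starts within 21 of the king, and its legality is decided within a further
  -- 21.
  refine ⟨ball 42 k, fun g' hs hg' => ?_⟩
  have h14 : ∀ u ∈ ball 14 k, g'.current.board u = g.current.board u := fun u hu =>
    hs.board u (ball_subset (by norm_num) k hu)
  have hc' := hc.congr hg hk h14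
  have hk' := (h14 k (self_mem_ball _ k)).trans hk
  refine ⟨hs.toMove.trans hb, hc', ?_⟩
  rintro ⟨s, t, hst⟩
  rw [hs.toMove.trans hb] at hst
  have hsk := hst.source_mem_ball_of_inCheck hg' hk' hc'
  refine hm ⟨s, t, ?_⟩
  rw [hb]
  exact hst.congr hg' hg hk' (fun u hu => (h14 u hu).symm)
    fun u hu => (hs.board u (mem_ball_trans hsk hu)).symm

theorem Position.counter_afterMove_le {p p' : Position} {s t : Square}
    (hs : p'.board s = p.board s) (ht : p'.board t = p.board t) (hc : p'.counter ≤ p.counter) :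
    (p'.afterMove s t).counter ≤ (p.afterMove s t).counter := by
  unfold Position.afterMove
  rw [hs, ht]
  dsimp only
  split_ifs
  · exact le_rfl
  · exact Nat.succ_le_succ hc

theorem Position.counter_afterMove_le_succ (p : Position) (s t : Square) :
    (p.afterMove s t).counter ≤ p.counter + 1 := by
  simp only [Position.afterMove]
  split_ifs <;> omega

/-! ### Comparing Black's moves with a pass. -/

/-- The moves that start within distance seven of `T`, and have length at most seven. -/
noncomputable def movesNear (T : Finset Square) : Finset (Square × Square) :=
  (T.biUnion (ball 7)).biUnion fun s => (ball 7 s).image fun t => (s, t)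

theorem LegalMove.mem_movesNear {b : Board} {c : Player} {s t : Square} (h : LegalMove b c s t)
    {T : Finset Square} (hT : s ∈ T ∨ t ∈ T) : (s, t) ∈ movesNear T := by
  simp only [movesNear, Finset.mem_biUnion, Finset.mem_image, Prod.mk.injEq]
  refine ⟨s, ?_, t, h.mem_ball, rfl, rfl⟩
  rcases hT with hT | hT
  · exact ⟨s, hT, self_mem_ball _ s⟩
  · exact ⟨t, hT, mem_ball_comm.1 h.mem_ball⟩

/-- The property `P` of plays depends on finitely many squares only. -/
def HoldsNear (P : Play → Prop) (g : Play) : Prop :=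
  ∃ S : Finset Square, ∀ g', g.Similar S g' → g'.current.board.OneKingEach → P g'

/-- After all turns of Black outside a finite set of moves, a property holds that depends on
finitely many squares only and holds after a pass. -/
theorem exists_finset_of_pass {g : Play} {P : Play → Prop} (hg : g.current.board.OneKingEach)
    (hb : g.current.toMove = .black)
    (hpass : ¬ InCheck g.current.board .black → HoldsNear P (g.extend g.current.afterPass)) :
    ∃ S : Finset Square, ∃ M : Finset (Square × Square), ∀ g', g.Similar S g' →
      g'.current.board.OneKingEach → ∀ q, Turn g'.current q →
        P (g'.extend q) ∨ ∃ s t, (s, t) ∈ M ∧ LegalMove g'.current.board .black s t ∧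
          q = g'.current.afterMove s t := by
  obtain ⟨k, hk, -⟩ := hg .black
  obtain ⟨S, hS⟩ : ∃ S : Finset Square, ¬ InCheck g.current.board .black →
      ∀ g', (g.extend g.current.afterPass).Similar S g' → g'.current.board.OneKingEach →
        P g' := by
    by_cases hc : InCheck g.current.board .black
    · exact ⟨∅, fun h => (h hc).elim⟩
    · exact (hpass hc).imp fun _ h _ => h
  -- The exceptional moves include those touching `S` and, through `ball 21 k`, every reply to a
  -- check.
  refine ⟨S ∪ ball 14 k, movesNear (S ∪ ball 21 k), fun g' hs hg' q hq => ?_⟩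
  have hb' := hs.toMove.trans hb
  have h14 : ∀ u ∈ ball 14 k, g'.current.board u = g.current.board u := fun u hu =>
    hs.board u (Finset.mem_union_right _ hu)
  have hSs := hs.mono (Finset.subset_union_left (s₂ := ball 14 k))
  have hk' := (h14 k (self_mem_ball _ k)).trans hk
  have hone := hq.oneKingEach hg'
  cases hq with
  | move s t h =>
    rw [hb'] at h
    by_cases hM : (s, t) ∈ movesNear (S ∪ ball 21 k)
    · exact .inr ⟨s, t, hM, h, rfl⟩
    · have hM' := mt h.mem_movesNear hM
      simp only [Finset.mem_union, not_or] at hM'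
      -- A move outside the list shows that Black is not in check, so `g` allows the pass, which
      -- looks the same on `S`.
      refine .inl (hS (fun hc => ?_) _ (hSs.extend (fun u hu => ?_) ?_ ?_) hone)
      · exact hM'.1.2 (h.source_mem_ball_of_inCheck hg' hk' (hc.congr hg hk h14))
      · have hus : u ≠ s := by
          rintro rfl
          exact hM'.1.1 hu
        have hut : u ≠ t := by
          rintro rfl
          exact hM'.2.1 hu
        simpa [Position.afterMove, Position.afterPass, Board.afterMove_apply, hus, hut] using
          hSs.board u hu
      · simp [Position.afterMove, Position.afterPass, hs.toMove]
      · exact (Position.counter_afterMove_le_succ _ s t).trans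
          (Nat.succ_le_succ hs.counter)
  | pass _ hc =>
    refine .inl (hS (mt (inCheck_congr hg hg' hk h14).2 hc) _ (hSs.extend hSs.board ?_ ?_) hone)
    · simp [Position.afterPass, hs.toMove]
    · exact Nat.succ_le_succ hs.counter

/-- A property holding after a legal move and depending on finitely many squares holds after the
same move in similar plays. -/
theorem LegalMove.exists_finset {g : Play} {P : Play → Prop} {s t : Square}
    (hP : HoldsNear P (g.extend (g.current.afterMove s t))) :
    ∃ S : Finset Square, ∀ g', g.Similar S g' → g'.current.board.OneKingEach →
      LegalMove g'.current.board g'.current.toMove s t →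
        P (g'.extend (g'.current.afterMove s t)) := by
  obtain ⟨S, hS⟩ := hP
  refine ⟨S ∪ ball 21 s, fun g' hs hg' h => hS _ ?_ (h.oneKingEach hg')⟩
  have hss : g'.current.board s = g.current.board s :=
    hs.board s (Finset.mem_union_right _ (self_mem_ball _ s))
  refine (hs.mono Finset.subset_union_left).extend (fun u hu => ?_) ?_ ?_
  · exact Board.afterMove_congr hss (hs.board u (Finset.mem_union_left _ hu))
  · simp [Position.afterMove, hs.toMove]
  · exact Position.counter_afterMove_le hss
      (hs.board t (Finset.mem_union_right _ (ball_subset (by norm_num) s h.mem_ball))) hs.counter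

/-- Legality of a move depends on finitely many squares only. -/
theorem exists_finset_legalMove_iff {g : Play} (hg : g.current.board.OneKingEach)
    (s t : Square) : ∃ S : Finset Square, ∀ g', g.Similar S g' →
      g'.current.board.OneKingEach → (LegalMove g'.current.board g'.current.toMove s t ↔
        LegalMove g.current.board g.current.toMove s t) := by
  obtain ⟨k, hk, -⟩ := hg g.current.toMove
  refine ⟨ball 14 k ∪ ball 21 s, fun g' hs hg' => ?_⟩
  have h14 : ∀ u ∈ ball 14 k, g'.current.board u = g.current.board u := fun u hu =>
    hs.board u (Finset.mem_union_left _ hu)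
  have h21 : ∀ u ∈ ball 21 s, g'.current.board u = g.current.board u := fun u hu =>
    hs.board u (Finset.mem_union_right _ hu)
  rw [hs.toMove]
  exact ⟨.congr hg' hg ((h14 k (self_mem_ball _ k)).trans hk)
    (fun u hu => (h14 u hu).symm) (fun u hu => (h21 u hu).symm), .congr hg hg' hk h14 h21⟩

/-! ### Locality of forced wins and the uniform bound. -/

/-- A forced win in `n` moves depends on finitely many squares only. -/
theorem WinsWithin.holdsNear {n : ℕ} {g : Play} (h : WinsWithin n g)
    (hg : g.current.board.OneKingEach) : HoldsNear (WinsWithin n) g := by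
  induction h with
  | mated h =>
    obtain ⟨S, hS⟩ := h.exists_finset hg
    exact ⟨S, fun g' hs hg' => .mated (hS g' hs hg')⟩
  | @white n g g₁ h hw hn _ ih =>
    have ih := ih (hn.2.1.oneKingEach hg)
    obtain ⟨S, hS⟩ := h.exists_finset hg
    rw [hn.eq_extend] at ih
    have ht := hn.2.1
    generalize g₁.current = q at ht ih
    cases ht with
    | move s t hl =>
      obtain ⟨T, hT⟩ := LegalMove.exists_finset ih
      obtain ⟨U, hU⟩ := exists_finset_legalMove_iff hg s t
      refine ⟨S ∪ (T ∪ U), fun g' hs hg' => ?_⟩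
      have ho := hS g' (hs.mono Finset.subset_union_left) hg'
      have hl' := (hU g' (hs.mono (Finset.subset_union_right.trans Finset.subset_union_right))
        hg').2 hl
      exact .white ho (hs.toMove.trans hw) (ho.next (.move s t hl')) (hT g'
        (hs.mono (Finset.subset_union_left.trans Finset.subset_union_right)) hg' hl')
    | pass hb => simp [hw] at hb
  | @black n g h hb hn ih =>
    obtain ⟨S, hS⟩ := h.exists_finset hg
    obtain ⟨T, M, hTM⟩ := exists_finset_of_pass (P := WinsWithin n) hg hb fun hc =>
      ih _ (h.next (.pass hb hc)) hg
    -- Each exceptional move has its own finite set: one on which its illegality is visible, or one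
    -- on which the win after it depends.
    have hloc : ∀ m : Square × Square, ∃ U : Finset Square, ∀ g', g.Similar U g' →
        g'.current.board.OneKingEach → LegalMove g'.current.board g'.current.toMove m.1 m.2 →
          WinsWithin n (g'.extend (g'.current.afterMove m.1 m.2)) := by
      rintro ⟨s, t⟩
      obtain ⟨U, hU⟩ := exists_finset_legalMove_iff hg s t
      by_cases hl : LegalMove g.current.board g.current.toMove s t
      · exact LegalMove.exists_finset (ih _ (h.next (.move s t hl)) (hl.oneKingEach hg))
      · exact ⟨U, fun g' hs hg' hl' => (hl ((hU g' hs hg').1 hl')).elim⟩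
    choose U hU using hloc
    refine ⟨S ∪ (T ∪ M.biUnion U), fun g' hs hg' => ?_⟩
    have hb' := hs.toMove.trans hb
    refine .black (hS g' (hs.mono Finset.subset_union_left) hg') hb' fun g'' hn' => ?_
    rw [hn'.eq_extend]
    rcases hTM g' (hs.mono (Finset.subset_union_left.trans Finset.subset_union_right)) hg' _
      hn'.2.1 with hw | ⟨s, t, hM, hl, hq⟩
    · exact hw
    · rw [hq]
      refine hU (s, t) g' (hs.mono ?_) hg' (by rwa [hb'])
      exact (Finset.subset_biUnion_of_mem U hM).trans
        (Finset.subset_union_right.trans Finset.subset_union_right)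

/-- If White has a forced win in finitely many moves after every turn of Black, then the number
of moves is bounded. -/
theorem exists_uniform_winsWithin {g : Play} (h : g.Ongoing) (hg : g.current.board.OneKingEach)
    (hb : g.current.toMove = .black) (hw : ∀ g', g.Next g' → ∃ n, WinsWithin n g') :
    ∃ n, ∀ g', g.Next g' → WinsWithin n g' := by
  obtain ⟨N, hN⟩ : ∃ N, ¬ InCheck g.current.board .black →
      WinsWithin N (g.extend g.current.afterPass) := by
    by_cases hc : InCheck g.current.board .black
    · exact ⟨0, fun h => (h hc).elim⟩
    · exact (hw _ (h.next (.pass hb hc))).imp fun _ h _ => h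
  obtain ⟨T, M, hTM⟩ := exists_finset_of_pass (P := WinsWithin N) hg hb fun hc =>
    (hN hc).holdsNear hg
  have hloc : ∀ m : Square × Square, ∃ n, LegalMove g.current.board .black m.1 m.2 →
      WinsWithin n (g.extend (g.current.afterMove m.1 m.2)) := by
    intro m
    by_cases hl : LegalMove g.current.board .black m.1 m.2
    · exact (hw _ (h.next (.move m.1 m.2 (by rwa [hb])))).imp fun _ h _ => h
    · exact ⟨0, fun h => (hl h).elim⟩
  choose f hf using hloc
  refine ⟨max N (M.sup f), fun g' hn => ?_⟩
  rw [hn.eq_extend]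
  rcases hTM g (.refl T g) hg _ hn.2.1 with hw | ⟨s, t, hM, hl, hq⟩
  · exact hw.mono (le_max_left _ _)
  · rw [hq]
    exact (hf (s, t) hl).mono ((Finset.le_sup (f := f) hM).trans (le_max_right _ _))

/-! ### From bounded wins to ordinal values. -/

theorem Play.BlackMated.not_ongoing {g : Play} (h : g.BlackMated) : ¬ g.Ongoing :=
  fun ho => h.2.2 ho.1

theorem WinsWithin.exists_hasGameValue {n : ℕ} {g : Play} (h : WinsWithin n g) :
    ∃ α : Ordinal.{0}, α ≤ n ∧ HasGameValue α g := by
  induction h with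
  | mated h =>
    refine ⟨0, zero_le, ?_⟩
    rw [HasGameValue]
    exact .inl ⟨h, rfl⟩
  | @white n g g' h hw hn _ ih =>
    obtain ⟨γ, hγ, hγ'⟩ := ih
    obtain ⟨β, ⟨g₁, hn₁, hβ⟩, hmin⟩ := WellFounded.has_min (wellFounded_lt (α := Ordinal.{0}))
      {β | ∃ g', g.Next g' ∧ HasGameValue β g'} ⟨γ, g', hn, hγ'⟩
    have hβγ : β ≤ γ := not_lt.1 (hmin γ ⟨g', hn, hγ'⟩)
    refine ⟨β + 1, ?_, ?_⟩
    · push_cast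
      exact add_le_add_left (hβγ.trans hγ) 1
    · rw [HasGameValue]
      exact .inr (.inl ⟨h, hw, β, Order.lt_add_one_iff.2 le_rfl, rfl, ⟨g₁, hn₁, hβ⟩,
        fun δ hδ g₂ hn₂ hv => hmin δ ⟨g₂, hn₂, hv⟩ hδ⟩)
  | @black n g h hb _ ih =>
    have ih' : ∀ g', ∃ α : Ordinal.{0}, g.Next g' → α ≤ n ∧ HasGameValue α g' := fun g' => by
      by_cases hn : g.Next g'
      · exact (ih g' hn).imp fun _ h _ => h
      · exact ⟨0, fun h => (hn h).elim⟩
    choose f hf using ih'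
    have hbdd : (n : Ordinal.{0}) ∈ upperBounds {β | ∃ g', g.Next g' ∧ f g' = β} := by
      rintro _ ⟨g', hn, rfl⟩
      exact (hf g' hn).1
    have hlub := isLUB_csSup' ⟨_, hbdd⟩
    refine ⟨_, hlub.2 hbdd, ?_⟩
    rw [HasGameValue]
    exact .inr (.inr ⟨h, hb, f, fun g' hn => ⟨hlub.1 ⟨g', hn, rfl⟩, (hf g' hn).2⟩, hlub⟩)

/-- At White's turn, the winning successor has some value at most the bound by
`WinsWithin.exists_hasGameValue`, and minimality of `β` compares with it. No uniqueness of values is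
needed. -/
theorem HasGameValue.le_of_winsWithin {n : ℕ} {g : Play} (h : WinsWithin n g)
    {α : Ordinal.{0}} (hα : HasGameValue α g) : α ≤ n := by
  induction h generalizing α with
  | mated h =>
    rw [HasGameValue] at hα
    rcases hα with ⟨-, rfl⟩ | ⟨ho, -⟩ | ⟨ho, -⟩
    · exact zero_le
    · exact (h.not_ongoing ho).elim
    · exact (h.not_ongoing ho).elim
  | @white n g g' h hw hn hg' _ =>
    rw [HasGameValue] at hα
    rcases hα with ⟨hm, -⟩ | ⟨-, -, β, -, rfl, -, hmin⟩ | ⟨-, hb, -⟩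
    · exact (hm.not_ongoing h).elim
    · obtain ⟨γ, hγ, hv⟩ := hg'.exists_hasGameValue
      push_cast
      exact add_le_add_left ((not_lt.1 fun hlt => hmin γ hlt g' hn hv).trans hγ) 1
    · simp [hw] at hb
  | @black n g h hb _ ih =>
    rw [HasGameValue] at hα
    rcases hα with ⟨hm, -⟩ | ⟨-, hw, -⟩ | ⟨-, -, f, hf, hlub⟩
    · exact (hm.not_ongoing h).elim
    · simp [hb] at hw
    · refine hlub.2 ?_
      rintro _ ⟨g', hn, rfl⟩
      exact ih g' hn (hf g' hn).2

theorem HasGameValue.exists_nat {α : Ordinal.{0}} {g : Play} (hα : HasGameValue α g)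
    (hg : g.current.board.OneKingEach) : ∃ n : ℕ, α = n ∧ WinsWithin n g := by
  induction α using WellFoundedLT.induction generalizing g with
  | ind α ih =>
    -- After a turn of Black the value may still be `α`, out of reach of `ih`. White is then to
    -- move, and one more turn lowers the value strictly.
    have hwhite : ∀ γ ≤ α, ∀ g : Play, g.current.board.OneKingEach → g.current.toMove = .white →
        HasGameValue γ g → ∃ n : ℕ, γ = n ∧ WinsWithin n g := by
      intro γ hγ g hg hw hv
      rw [HasGameValue] at hv
      rcases hv with ⟨hm, -⟩ | ⟨ho, -, β, hβ, rfl, ⟨g', hn, hv⟩, -⟩ | ⟨-, hb, -⟩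
      · simpa [hw] using hm.1
      · obtain ⟨n, rfl, hwin⟩ := ih β (hβ.trans_le hγ) hv (hn.2.1.oneKingEach hg)
        exact ⟨n + 1, by push_cast; rfl, .white ho hw hn hwin⟩
      · simp [hw] at hb
    by_cases hw : g.current.toMove = .white
    · exact hwhite α le_rfl g hg hw hα
    rw [HasGameValue] at hα
    rcases hα with ⟨hm, rfl⟩ | ⟨-, hw', -⟩ | ⟨ho, hb, f, hf, hlub⟩
    · exact ⟨0, by simp, .mated hm⟩
    · exact (hw hw').elim
    · have hfin : ∀ g', g.Next g' → ∃ n : ℕ, f g' = n ∧ WinsWithin n g' := fun g' hn => by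
        obtain ⟨hle, hv⟩ := hf g' hn
        exact hwhite _ hle g' (hn.2.1.oneKingEach hg) (by rw [hn.toMove, hb]; rfl) hv
      obtain ⟨N, hN⟩ := exists_uniform_winsWithin ho hg hb fun g' hn =>
        (hfin g' hn).imp fun _ h => h.2
      have hαN : α ≤ N := hlub.2 <| by
        rintro _ ⟨g', hn, rfl⟩
        exact (hf g' hn).2.le_of_winsWithin (hN g' hn)
      obtain ⟨n, rfl⟩ := Ordinal.lt_omega0.1 (hαN.trans_lt (Ordinal.natCast_lt_omega0 N))
      -- `N` served only to show that `α` is finite; every reply has value at most `α = n`, so the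
      -- win takes at most `n` moves.
      refine ⟨n, rfl, .black ho hb fun g' hn => ?_⟩
      obtain ⟨m, hm, hwin⟩ := hfin g' hn
      exact hwin.mono (by exact_mod_cast hm ▸ (hf g' hn).1)

end ShortRangeChess

theorem mainTheorem4 (p : ShortRangeChess.Position) (hp : p.OneKingEach)
    (g : ShortRangeChess.Play)
    (hg : Relation.ReflTransGen ShortRangeChess.Play.Next (ShortRangeChess.Play.start p) g)
    (α : Ordinal.{0}) (hα : ShortRangeChess.HasGameValue α g) :
    ∃ n : ℕ, α = n := by
  have hg' : g.current.board.OneKingEach := by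
    clear hα
    induction hg with
    | refl => exact hp
    | tail _ hn ih => exact hn.2.1.oneKingEach ih
  obtain ⟨n, hn, -⟩ := hα.exists_nat hg'
  exact ⟨n, hn⟩
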